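/- **Theorem 3.1.** Let $k$ be a field, let $V$ be a finite-dimensional $k$-vector space, and let $k\ltimes V$ be the trivial extension algebra, i.e. the $k$-vector space $k\oplus V$ with multiplication $(a,v)(b,w)=(ab,\,bv+aw)$. A module is called indecomposable if it is nonzero and is not the direct sum of two nonzero submodules, and its Goldie dimension is the supremum of all $n$ such that it contains a direct sum of $n$ nonzero submodules. 1. If $\operatorname{char} k\neq 2$, then for every integer $m$ with $1\le m\le 3\dim_k V-2$ there exists an indecomposable $k\ltimes V$-module of Goldie dimension $m$. 2. If $\operatorname{char} k=2$, then for every integer $m$ satisfying $1\le m\le \dim_k V$, or $\dim_k V+\lfloor \dim_k V/2\rfloor<m\le 2\dim_k V-1$, or $2\dim_k V+\lfloor \dim_k V/2\rfloor-1<m\le 3\dim_k V-2$, there exists an indecomposable $k\ltimes V$-module of Goldie dimension $m$. -/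

import Mathlib

universe u v

/-- A module is indecomposable if it is nonzero and whenever it is the (internal) direct sum of two
submodules, one of them is zero. -/
def IsIndecomposableModule (R : Type*) (M : Type*) [Ring R] [AddCommGroup M] [Module R M] : Prop :=
  Nontrivial M ∧ ∀ N₁ N₂ : Submodule R M, IsCompl N₁ N₂ → N₁ = ⊥ ∨ N₂ = ⊥

/-- The Goldie (uniform) dimension of a module: the supremum in `ℕ∞` of all `n` such that the
module contains `n` nonzero submodules whose sum is direct. -/
noncomputable def goldieDim (R : Type*) (M : Type*) [Ring R] [AddCommGroup M] [Module R M] : ℕ∞ :=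
  ⨆ n : {n : ℕ // ∃ N : Fin n → Submodule R M, (∀ i, N i ≠ ⊥) ∧ iSupIndep N}, ((n : ℕ) : ℕ∞)

/-!
The algebra `k ⋉ V` is local with square-zero radical `V`, so a linear map `φ : V → A` into a
commutative `k`-algebra `A` makes `A × A` a module on which `v ∈ V` sends `(x, y)` to
`(0, φ v * x)`. If `1` lies in the range of `φ`, the elements killed by `V` are exactly those of
`0 × A`, every nonzero submodule meets `0 × A`, and `k`-subspaces of `0 × A` are submodules. Hence
the Goldie dimension is `dim_k A` (`KroneckerModule.goldieDim_eq`).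

A decomposition of `A × A` induces a decomposition `A = S₁ ⊕ S₂` with both summands stable under
multiplication by the range of `φ`. If that range generates the algebra `A`, then `S₁` and `S₂` are
ideals, and one of them vanishes when `A` is local (`KroneckerModule.isIndecomposable`).

Taking `A = k[X] / (X ^ m)`, which is local of dimension `m` and generated by the class of `X`,
gives an indecomposable module of Goldie dimension `m` for *every* `m ≥ 1` as soon as
`2 ≤ dim_k V`, in any characteristic. When `dim_k V = 1` only `m = 1` is asked for, and then
`A = k`.
-/

/-! ### The module attached to a linear map into an algebra -/

/-- The space `A × A` regarded as a module over `TrivSqZeroExt k V`: scalars of `k` act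
componentwise and `v : V` acts by `(x, y) ↦ (0, φ v * x)`. It is the representation of the
generalised Kronecker quiver with arrow space `V` and both vertices carrying `A`. The linear map
`φ` is only a label of the type synonym. -/
@[nolint unusedArguments]
def KroneckerModule {k V A : Type*} [Field k] [AddCommGroup V] [Module k V] [CommRing A]
    [Algebra k A] (_φ : V →ₗ[k] A) : Type _ :=
  A × A

namespace KroneckerModule

variable {k V A : Type*} [Field k] [AddCommGroup V] [Module k V] [CommRing A] [Algebra k A]
  {φ : V →ₗ[k] A}

instance : AddCommGroup (KroneckerModule φ) :=
  inferInstanceAs (AddCommGroup (A × A))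

instance [Nontrivial A] : Nontrivial (KroneckerModule φ) :=
  inferInstanceAs (Nontrivial (A × A))

/-- The element `(x, y)` of `KroneckerModule φ`. -/
def mk (φ : V →ₗ[k] A) (x y : A) : KroneckerModule φ :=
  (x, y)

@[simp]
theorem fst_mk (x y : A) : (mk φ x y).1 = x :=
  rfl

@[simp]
theorem snd_mk (x y : A) : (mk φ x y).2 = y :=
  rfl

@[ext]
theorem ext {p q : KroneckerModule φ} (h₁ : p.1 = q.1) (h₂ : p.2 = q.2) : p = q :=
  Prod.ext h₁ h₂

@[simp]
theorem fst_add (p q : KroneckerModule φ) : (p + q).1 = p.1 + q.1 :=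
  rfl

@[simp]
theorem snd_add (p q : KroneckerModule φ) : (p + q).2 = p.2 + q.2 :=
  rfl

@[simp]
theorem fst_zero : (0 : KroneckerModule φ).1 = 0 :=
  rfl

@[simp]
theorem snd_zero : (0 : KroneckerModule φ).2 = 0 :=
  rfl

instance : SMul (TrivSqZeroExt k V) (KroneckerModule φ) :=
  ⟨fun r p => (r.fst • p.1, r.fst • p.2 + φ r.snd * p.1)⟩

@[simp]
theorem fst_smul (r : TrivSqZeroExt k V) (p : KroneckerModule φ) : (r • p).1 = r.fst • p.1 :=
  rfl

@[simp]
theorem snd_smul (r : TrivSqZeroExt k V) (p : KroneckerModule φ) :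
    (r • p).2 = r.fst • p.2 + φ r.snd * p.1 :=
  rfl

variable [Module kᵐᵒᵖ V] [IsCentralScalar k V]

instance : Module (TrivSqZeroExt k V) (KroneckerModule φ) where
  one_smul p := by ext <;> simp
  mul_smul r s p := by
    ext
    · simp [mul_smul]
    · simp only [snd_smul, fst_smul, TrivSqZeroExt.fst_mul, TrivSqZeroExt.snd_mul,
        op_smul_eq_smul, map_add, map_smul, mul_smul, smul_add, add_mul, smul_mul_assoc,
        mul_smul_comm]
      abel
  smul_zero r := by ext <;> simp
  smul_add r p q := by
    ext
    · simp
    · simp only [snd_smul, snd_add, fst_add, smul_add, mul_add]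
      abel
  add_smul r s p := by
    ext
    · simp [add_smul]
    · simp only [snd_smul, snd_add, TrivSqZeroExt.fst_add, TrivSqZeroExt.snd_add, map_add,
        add_smul, add_mul]
      abel
  zero_smul p := by ext <;> simp

/-! ### Submodules and the bottom component -/

/-- The `k`-subspace of `A` formed by the `y` with `(0, y) ∈ N`. -/
def bottom (N : Submodule (TrivSqZeroExt k V) (KroneckerModule φ)) : Submodule k A where
  carrier := {y | mk φ 0 y ∈ N}
  zero_mem' := N.zero_mem
  add_mem' {x y} hx hy := by
    have e : mk φ 0 x + mk φ 0 y = mk φ 0 (x + y) := by ext <;> simp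
    exact Set.mem_ofPred.2 (e ▸ N.add_mem hx hy)
  smul_mem' c y hy := by
    have e : (TrivSqZeroExt.inl c : TrivSqZeroExt k V) • mk φ 0 y = mk φ 0 (c • y) := by
      ext <;> simp
    exact Set.mem_ofPred.2 (e ▸ N.smul_mem (TrivSqZeroExt.inl c) hy)

theorem mem_bottom {N : Submodule (TrivSqZeroExt k V) (KroneckerModule φ)} {y : A} :
    y ∈ bottom N ↔ mk φ 0 y ∈ N :=
  Iff.rfl

/-- A `k`-subspace `P` of `A` placed in the second component: the submodule `0 × P`. -/
def ofBottom (φ : V →ₗ[k] A) (P : Submodule k A) :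
    Submodule (TrivSqZeroExt k V) (KroneckerModule φ) where
  carrier := {p | p.1 = 0 ∧ p.2 ∈ P}
  zero_mem' := ⟨rfl, P.zero_mem⟩
  add_mem' {p q} hp hq := ⟨by simp [hp.1, hq.1], P.add_mem hp.2 hq.2⟩
  smul_mem' r p hp := ⟨by simp [hp.1], by simpa [hp.1] using P.smul_mem r.fst hp.2⟩

theorem bottom_mono {N₁ N₂ : Submodule (TrivSqZeroExt k V) (KroneckerModule φ)} (h : N₁ ≤ N₂) :
    bottom N₁ ≤ bottom N₂ :=
  fun _ hy => h hy

theorem ofBottom_mono {P Q : Submodule k A} (h : P ≤ Q) : ofBottom φ P ≤ ofBottom φ Q :=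
  fun _ hp => ⟨hp.1, h hp.2⟩

theorem disjoint_bottom {N₁ N₂ : Submodule (TrivSqZeroExt k V) (KroneckerModule φ)}
    (h : Disjoint N₁ N₂) : Disjoint (bottom N₁) (bottom N₂) := by
  rw [Submodule.disjoint_def] at h ⊢
  exact fun y h₁ h₂ => congrArg Prod.snd (h _ h₁ h₂)

theorem disjoint_ofBottom {P Q : Submodule k A} (h : Disjoint P Q) :
    Disjoint (ofBottom φ P) (ofBottom φ Q) := by
  rw [Submodule.disjoint_def] at h ⊢
  exact fun p h₁ h₂ => ext h₁.1 (h _ h₁.2 h₂.2)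

theorem iSupIndep_bottom {ι : Type*}
    {N : ι → Submodule (TrivSqZeroExt k V) (KroneckerModule φ)} (h : iSupIndep N) :
    iSupIndep fun i => bottom (N i) := fun i =>
  (disjoint_bottom (h i)).mono_right <|
    iSup₂_le fun j hj => bottom_mono (le_iSup₂ (f := fun j (_ : j ≠ i) => N j) j hj)

theorem iSupIndep_ofBottom {ι : Type*} {P : ι → Submodule k A} (h : iSupIndep P) :
    iSupIndep fun i => ofBottom φ (P i) := fun i =>
  (disjoint_ofBottom (h i)).mono_right <|
    iSup₂_le fun j hj => ofBottom_mono (le_iSup₂ (f := fun j (_ : j ≠ i) => P j) j hj)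

theorem map_mul_fst_mem_bottom {N : Submodule (TrivSqZeroExt k V) (KroneckerModule φ)}
    {p : KroneckerModule φ} (hp : p ∈ N) (v : V) : φ v * p.1 ∈ bottom N := by
  have e : (TrivSqZeroExt.inr v : TrivSqZeroExt k V) • p = mk φ 0 (φ v * p.1) := by
    ext <;> simp
  exact mem_bottom.2 (e ▸ N.smul_mem (TrivSqZeroExt.inr v) hp)

theorem fst_mem_bottom {N : Submodule (TrivSqZeroExt k V) (KroneckerModule φ)}
    {p : KroneckerModule φ} (hp : p ∈ N) (h1 : (1 : A) ∈ Set.range φ) : p.1 ∈ bottom N := by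
  obtain ⟨v, hv⟩ := h1
  simpa [hv] using map_mul_fst_mem_bottom hp v

/-- Every nonzero submodule meets `0 × A`, because the vector acting as `1` moves first components
to second components. -/
theorem eq_bot_of_bottom_eq_bot {N : Submodule (TrivSqZeroExt k V) (KroneckerModule φ)}
    (h1 : (1 : A) ∈ Set.range φ) (h : bottom N = ⊥) : N = ⊥ := by
  refine (Submodule.eq_bot_iff N).2 fun p hp => ?_
  have hx : p.1 = 0 := by
    have := fst_mem_bottom hp h1
    rwa [h, Submodule.mem_bot] at this
  have hy : p.2 ∈ bottom N := by
    have e : p = mk φ 0 p.2 := ext hx rfl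
    exact mem_bottom.2 (e ▸ hp)
  rw [h, Submodule.mem_bot] at hy
  exact ext hx hy

/-! ### Goldie dimension -/

theorem goldieDim_eq [Module.Finite k A] (h1 : (1 : A) ∈ Set.range φ) :
    goldieDim (TrivSqZeroExt k V) (KroneckerModule φ) = (Module.finrank k A : ℕ∞) := by
  refine le_antisymm (iSup_le ?_) ?_
  · rintro ⟨n, N, hN, hind⟩
    have hne : ∀ i, bottom (N i) ≠ ⊥ := fun i h => hN i (eq_bot_of_bottom_eq_bot h1 h)
    have hle := (iSupIndep_bottom hind).subtype_ne_bot_le_finrank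
    rw [Fintype.card_congr (Equiv.subtypeUnivEquiv hne), Fintype.card_fin] at hle
    exact_mod_cast hle
  · let b := Module.finBasis k A
    refine le_iSup_of_le (ι := {n : ℕ // _}) ⟨Module.finrank k A,
      fun i => ofBottom φ (Submodule.span k {b i}), fun i h => ?_,
      iSupIndep_ofBottom b.linearIndependent.iSupIndep_span_singleton⟩ le_rfl
    have hmem : mk φ 0 (b i) ∈ ofBottom φ (Submodule.span k {b i}) :=
      ⟨rfl, Submodule.mem_span_singleton_self _⟩
    have hzero : mk φ 0 (b i) = 0 := by simpa [h] using hmem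
    exact b.ne_zero i (congrArg Prod.snd hzero)

/-! ### Indecomposability -/

section IsCompl

variable {N₁ N₂ : Submodule (TrivSqZeroExt k V) (KroneckerModule φ)}

/-- Each `y` is a sum of *first* components of elements of the two summands, and these first
components already lie in the bottom components. -/
theorem exists_fst_add_fst_eq (hN : IsCompl N₁ N₂) (y : A) :
    ∃ p₁ ∈ N₁, ∃ p₂ ∈ N₂, p₁.1 + p₂.1 = y := by
  have hy : mk φ y 0 ∈ N₁ ⊔ N₂ := hN.sup_eq_top ▸ Submodule.mem_top
  obtain ⟨p₁, h₁, p₂, h₂, e⟩ := Submodule.mem_sup.1 hy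
  exact ⟨p₁, h₁, p₂, h₂, congrArg Prod.fst e⟩

theorem bottom_sup_bottom_eq_top (hN : IsCompl N₁ N₂) (h1 : (1 : A) ∈ Set.range φ) :
    bottom N₁ ⊔ bottom N₂ = ⊤ := by
  refine eq_top_iff.2 fun y _ => ?_
  obtain ⟨p₁, h₁, p₂, h₂, rfl⟩ := exists_fst_add_fst_eq hN y
  exact Submodule.add_mem_sup (fst_mem_bottom h₁ h1) (fst_mem_bottom h₂ h1)

theorem map_mul_mem_bottom (hN : IsCompl N₁ N₂) (h1 : (1 : A) ∈ Set.range φ) (v : V) {y : A}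
    (hy : y ∈ bottom N₁) : φ v * y ∈ bottom N₁ := by
  obtain ⟨p₁, h₁, p₂, h₂, rfl⟩ := exists_fst_add_fst_eq hN y
  -- The component of `y` along `N₂` vanishes since `bottom N₁` and `bottom N₂` are disjoint.
  have hp₂ : p₂.1 = 0 := by
    refine Submodule.disjoint_def.1 (disjoint_bottom hN.disjoint) _ ?_ (fst_mem_bottom h₂ h1)
    simpa using Submodule.sub_mem _ hy (fst_mem_bottom h₁ h1)
  rw [hp₂, add_zero]
  exact map_mul_fst_mem_bottom h₁ v

theorem mul_mem_bottom (hN : IsCompl N₁ N₂) (h1 : (1 : A) ∈ Set.range φ)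
    (hφ : Algebra.adjoin k (Set.range φ) = ⊤) (a : A) {y : A} (hy : y ∈ bottom N₁) :
    a * y ∈ bottom N₁ := by
  have ha : a ∈ Algebra.adjoin k (Set.range φ) := hφ ▸ Algebra.mem_top
  induction ha using Algebra.adjoin_induction generalizing y with
  | mem x hx =>
    obtain ⟨v, rfl⟩ := hx
    exact map_mul_mem_bottom hN h1 v hy
  | algebraMap c =>
    rw [← Algebra.smul_def]
    exact Submodule.smul_mem _ c hy
  | add a b _ _ iha ihb =>
    rw [add_mul]
    exact Submodule.add_mem _ (iha hy) (ihb hy)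
  | mul a b _ _ iha ihb =>
    rw [mul_assoc]
    exact iha (ihb hy)

end IsCompl

theorem isIndecomposable [IsLocalRing A] (h1 : (1 : A) ∈ Set.range φ)
    (hφ : Algebra.adjoin k (Set.range φ) = ⊤) :
    IsIndecomposableModule (TrivSqZeroExt k V) (KroneckerModule φ) := by
  refine ⟨inferInstance, fun N₁ N₂ hN => ?_⟩
  -- If the bottom component of one summand contains a unit, it is everything, being an ideal.
  have key : ∀ {N N' : Submodule (TrivSqZeroExt k V) (KroneckerModule φ)}, IsCompl N N' →
      ∀ a ∈ bottom N, IsUnit a → N' = ⊥ := by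
    intro N N' h a ha hu
    obtain ⟨c, hc⟩ := hu.exists_left_inv
    refine eq_bot_of_bottom_eq_bot h1 ((Submodule.eq_bot_iff _).2 fun y hy => ?_)
    refine Submodule.disjoint_def.1 (disjoint_bottom h.disjoint) y ?_ hy
    have := mul_mem_bottom h h1 hφ (y * c) ha
    rwa [mul_assoc, hc, mul_one] at this
  have hone : (1 : A) ∈ bottom N₁ ⊔ bottom N₂ := bottom_sup_bottom_eq_top hN h1 ▸ Submodule.mem_top
  obtain ⟨a, ha, b, hb, hab⟩ := Submodule.mem_sup.1 hone
  rcases IsLocalRing.isUnit_or_isUnit_of_add_one hab with hu | hu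
  · exact Or.inr (key hN a ha hu)
  · exact Or.inl (key hN.symm b hb hu)

end KroneckerModule

/-! ### Truncated polynomial algebras -/

theorem AdjoinRoot.isLocalRing_X_pow (k : Type*) [Field k] {m : ℕ} (hm : m ≠ 0) :
    IsLocalRing (AdjoinRoot (Polynomial.X ^ m : Polynomial k)) := by
  have : Nontrivial (AdjoinRoot (Polynomial.X ^ m : Polynomial k)) :=
    AdjoinRoot.nontrivial _ (by simpa using hm)
  refine IsLocalRing.of_isUnit_or_isUnit_one_sub_self fun a => ?_
  induction a using AdjoinRoot.induction_on with | ih p =>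
  by_cases hp : Polynomial.X ∣ p
  · refine Or.inr (IsNilpotent.isUnit_one_sub ⟨m, ?_⟩)
    rw [← map_pow, AdjoinRoot.mk_eq_zero]
    exact pow_dvd_pow_of_dvd hp m
  · obtain ⟨u, v, h⟩ : IsCoprime (Polynomial.X ^ m) p :=
      ((Polynomial.irreducible_X.coprime_iff_not_dvd).2 hp).pow_left
    refine Or.inl (IsUnit.of_mul_eq_one_right (AdjoinRoot.mk _ v) ?_)
    simpa using congrArg (AdjoinRoot.mk (Polynomial.X ^ m)) h

/-- In each universe there is a local algebra of dimension `m` generated by one element, namely a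
copy of `k[X] / (X ^ m)`. -/
theorem exists_isLocalRing_finrank_eq (k : Type u) [Field k] {m : ℕ} (hm : m ≠ 0) :
    ∃ (A : Type (max u v)) (_ : CommRing A) (_ : Algebra k A) (a : A),
      IsLocalRing A ∧ Module.Finite k A ∧ Module.finrank k A = m ∧
        Algebra.adjoin k {a} = ⊤ := by
  have := AdjoinRoot.isLocalRing_X_pow k hm
  have hmonic : (Polynomial.X ^ m : Polynomial k).Monic := Polynomial.monic_X_pow m
  let e : AdjoinRoot (Polynomial.X ^ m : Polynomial k) ≃ₐ[k]
    ULift.{v} (AdjoinRoot (Polynomial.X ^ m : Polynomial k)) := ULift.algEquiv.symm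
  have := (AdjoinRoot.powerBasis' hmonic).finite
  refine ⟨_, inferInstance, inferInstance, e (AdjoinRoot.root _), e.toRingEquiv.isLocalRing,
    Module.Finite.equiv e.toLinearEquiv, ?_, ?_⟩
  · rw [← e.toLinearEquiv.finrank_eq, (AdjoinRoot.powerBasis' hmonic).finrank]
    simp
  · rw [← Set.image_singleton, ← AlgEquiv.coe_toAlgHom, ← AlgHom.map_adjoin,
      AdjoinRoot.adjoinRoot_eq_top]
    simpa [AlgHom.range_eq_top] using e.surjective

theorem exists_indecomposable_goldieDim_eq (k : Type u) [Field k] (V : Type v) [AddCommGroup V]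
    [Module k V] [Module kᵐᵒᵖ V] [IsCentralScalar k V] [Module.Finite k V] {m : ℕ} (hm : m ≠ 0)
    (hV : 2 ≤ Module.finrank k V ∨ Module.finrank k V = 1 ∧ m = 1) :
    ∃ (M : Type (max u v)) (_ : AddCommGroup M) (_ : Module (TrivSqZeroExt k V) M),
      IsIndecomposableModule (TrivSqZeroExt k V) M ∧
        goldieDim (TrivSqZeroExt k V) M = (m : ℕ∞) := by
  obtain ⟨A, _, _, a, _, _, hA, ha⟩ := exists_isLocalRing_finrank_eq.{u, v} k hm
  have hpos : 0 < Module.finrank k V := by omega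
  let b := Module.finBasis k V
  -- One basis vector acts as `1`, all others as the generator `a`.
  let φ : V →ₗ[k] A := b.constr k fun i => if (i : ℕ) = 0 then 1 else a
  have h1 : (1 : A) ∈ Set.range φ := ⟨b ⟨0, hpos⟩, by simp only [φ, b.constr_basis, if_true]⟩
  have hφ : Algebra.adjoin k (Set.range φ) = ⊤ := by
    rcases hV with hV | ⟨-, rfl⟩
    · refine top_unique (ha ▸ Algebra.adjoin_mono (Set.singleton_subset_iff.2 ?_))
      exact ⟨b ⟨1, hV⟩, by simp only [φ, b.constr_basis, one_ne_zero, if_false]⟩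
    · exact top_unique (Subalgebra.bot_eq_top_of_finrank_eq_one hA ▸ bot_le)
  exact ⟨KroneckerModule φ, inferInstance, inferInstance,
    KroneckerModule.isIndecomposable h1 hφ, hA ▸ KroneckerModule.goldieDim_eq h1⟩

/- `TrivSqZeroExt k V` is `k × V` with `(a, v) * (b, w) = (a * b, a • w + b • v)`. The binders
`[Module kᵐᵒᵖ V] [IsCentralScalar k V]` only record the right action of the commutative field `k`
on `V`, which is forced to coincide with the left action. -/
theorem theorem3p1 (k : Type u) [Field k] (V : Type v) [AddCommGroup V] [Module k V]
    [Module kᵐᵒᵖ V] [IsCentralScalar k V] [Module.Finite k V] :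
    (ringChar k ≠ 2 →
      ∀ m : ℕ, 1 ≤ m → (m : ℤ) ≤ 3 * (Module.finrank k V : ℤ) - 2 →
        ∃ (M : Type (max u v)) (_ : AddCommGroup M) (_ : Module (TrivSqZeroExt k V) M),
          IsIndecomposableModule (TrivSqZeroExt k V) M ∧
            goldieDim (TrivSqZeroExt k V) M = (m : ℕ∞)) ∧
    (ringChar k = 2 →
      ∀ m : ℕ,
        ((1 ≤ m ∧ m ≤ Module.finrank k V) ∨
          ((Module.finrank k V : ℤ) + (Module.finrank k V / 2 : ℕ) < m ∧
            (m : ℤ) ≤ 2 * (Module.finrank k V : ℤ) - 1) ∨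
          (2 * (Module.finrank k V : ℤ) + (Module.finrank k V / 2 : ℕ) - 1 < m ∧
            (m : ℤ) ≤ 3 * (Module.finrank k V : ℤ) - 2)) →
        ∃ (M : Type (max u v)) (_ : AddCommGroup M) (_ : Module (TrivSqZeroExt k V) M),
          IsIndecomposableModule (TrivSqZeroExt k V) M ∧
            goldieDim (TrivSqZeroExt k V) M = (m : ℕ∞)) := by
  -- Both characteristics ask only for `m = 1` when `dim_k V = 1`, and for nothing when `V = 0`.
  refine ⟨fun _ m h₁ h₂ => ?_, fun _ m h => ?_⟩ <;>
    exact exists_indecomposable_goldieDim_eq k V (by omega) (by omega)
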